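/- **Setting.** Fix a set of state variables, a set of values, a set of action names and a constant domain $D$. A state assigns a value to every variable; a behavior is an infinite sequence of states. A specification $S$ has a finite set $\beta S$ of variables, an initial predicate $Init$ that is a finite conjunction of state formulas, and a finite set $\alpha S$ of action names; each $A\in\alpha S$ is defined, for a parameter $d\in D$, as a finite conjunction of formulas about the current and the next state together with a frame condition $\mathrm{UNCHANGED}\,U_A$. Every formula carries the finite set of the variables that occur in it. $S$ denotes the set $[\![S]\!]$ of behaviors satisfying $Init\wedge\Box[Next]_{\beta S}$, where $Next=\exists d\in D:\bigvee_{A\in\alpha S}A(d)$. A property $P$ is a temporal formula with finite set of variables $\beta P$ and set of behaviors $[\![P]\!]$, which depends only on the values of $\beta P$ and is invariant under stuttering; $S\models P$ means $[\![S]\!]\subseteq[\![P]\!]$. Parallel composition $\|$, of specifications and of labeled transition systems (LTSs), synchronizes common actions and interleaves all others; an action occurring in only one of two composed specifications leaves the variables of the other unchanged. $LTS(S)$ is the state graph of $S$ over assignments to $\beta S$, labeled with the concrete actions $A(d)$, $A\in\alpha S$, $d\in D$. $Err(S,P)$ is the error LTS: the state graph of $S$ in which each state also records what remains to be satisfied of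 $P$, and in which a step (or an initial state) that makes the history a bad prefix of $P$ leads to a sink state $\pi$. In a composition, every tuple with a component $\pi$ counts as $\pi$. **Algorithm Recomp-Verify**, on input $S$, $P$ and a recomposition strategy $\rho$. 1. *Decompose.* For a specification $T$ and a set of variables $V$, let $\mathrm{Partition}(T,V)=(V_C,V_T)$, where $V_C$ is obtained from $V$ by repeatedly adding all variables that occur, in some conjunct of the initial predicate or of an action of $T$ (frame conditions not counted), together with a variable already present, until nothing changes, and $V_T=\beta T\setminus V_C$. $\mathrm{Slice}(T,V)$ has the variables $\beta T\cap V$, keeps the conjuncts whose variables all lie in $V$, restricts the frame conditions to $V$, and deletes the actions none of whose conjuncts is kept. Start with $T_0=S$, $i=0$ and $(V_C,V_T)=\mathrm{Partition}(S,\beta P)$; while $V_T\ne\emptyset$, let $C_{i+1}=\mathrm{Slice}(T_i,V_C)$ and $T_{i+1}=\mathrm{Slice}(T_i,V_T)$, choose any $v\in\beta T_{i+1}$, let $(V_C,V_T)=\mathrm{Partition}(T_{i+1},\{v\})$ and increase $i$ by one. Finally, put $n=i+1$ and $C_n=T_i$. 2. *Recompose.* $\rho(C_1,\dots,C_n)$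 is a number $m$ with a surjection $f:\{C_1,\dots,C_n\}\to\{d_P,d_1,\dots,d_m\}$ such that $f(C_1)=d_P$. *Static reduction* restricts $f$ to $\bigcup_k X_k$, where $X_0=\{C_1\}$ and $X_{k+1}$ is the set of the $C_j$ that share an action name with a member of $X_k$, drops the $d_j$ that are no longer attained, and renumbers the others in the same order. Then $D_P$ is the parallel composition of $f^{-1}(d_P)$ and $D_j$ that of $f^{-1}(d_j)$. 3. *Comp-Verify.* Let $\mathcal D=Min(Err(D_P,P))$, where $Min$ is minimization up to observational equivalence; return true if $\pi$ is unreachable in $\mathcal D$. For $j=1,\dots,m$ in turn, replace $\mathcal D$ with $\mathcal D\,\|\,Min(LTS(D_j))$ and return true if $\pi$ is unreachable in it. If the loop ends, return false. The construction of $LTS(D_j)$, or of $Err(D_P,P)$, terminates only if it has finitely many reachable states. **Theorem.** Let $S$ be a well-formed specification: only variables of $\beta S$ occur in it, and for every action $A\in\alpha S$ every variable of $\beta S$ occurs in a conjunct of $A$ or belongs to $U_A$. Suppose that $Init$ is satisfiable, let $P$ be a safety property with $\beta P\subseteq\beta S$, and let $\rho$ be any recomposition strategy. Then for every run of Recomp-Verify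 on $(S,P,\rho)$ that terminates, whatever the nondeterministic choices, the run returns true if and only if $S\models P$. -/

import Mathlib

universe u v w

/-! ## Specifications

`Var` is the set of state variables, `Val` the set of values, `Act` the set of action names, and
`Param` the (constant) domain `D` over which the parameter of the actions ranges. -/

/-- A state assigns a value to every state variable. -/
abbrev TState (Var Val : Type u) : Type u := Var → Val

/-- A behavior is an infinite sequence of states. -/
abbrev Behavior (Var Val : Type u) : Type u := ℕ → TState Var Val

/-- A conjunct of an initial predicate: a state formula together with the finite set of the
variables that occur in it. Its truth value depends only on these variables. -/
structure InitConj (Var Val : Type u) where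
  vars : Finset Var
  holds : TState Var Val → Prop
  depends : ∀ s t : TState Var Val, (∀ x ∈ vars, s x = t x) → (holds s ↔ holds t)

/-- A conjunct of an action definition: a formula about a parameter, the current state and the next
state (primed variables), together with the finite set of the variables that occur in it, primed or
unprimed. Its truth value depends only on these variables. -/
structure ActConj (Var Val : Type u) (Param : Type w) where
  vars : Finset Var
  holds : Param → TState Var Val → TState Var Val → Prop
  depends : ∀ (d : Param) (s s' t t' : TState Var Val), (∀ x ∈ vars, s x = t x) →
    (∀ x ∈ vars, s' x = t' x) → (holds d s s' ↔ holds d t t')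

/-- The body of an action definition: a conjunction of formulas, and a frame condition
`UNCHANGED unch`. -/
structure ActionDef (Var Val : Type u) (Param : Type w) where
  conj : List (ActConj Var Val Param)
  unch : Finset Var

/-- The transitions allowed by an action with parameter `d`. -/
def ActionDef.Holds {Var Val : Type u} {Param : Type w} (a : ActionDef Var Val Param)
    (d : Param) (s s' : TState Var Val) : Prop :=
  (∀ c ∈ a.conj, c.holds d s s') ∧ ∀ x ∈ a.unch, s' x = s x

/-- A specification `Init ∧ □[Next]_vars`, where `Init` is the conjunction of the list `init`
and `Next` is `∃ d ∈ Param, ⋁ A ∈ acts, A(d)`, the action named `A` being defined by `body A`.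
(The value of `body` at names outside `acts` plays no role.) -/
structure TSpec (Var Val : Type u) (Act : Type v) (Param : Type w) where
  vars : Finset Var
  init : List (InitConj Var Val)
  acts : Finset Act
  body : Act → ActionDef Var Val Param

namespace TSpec

variable {Var Val : Type u} {Act : Type v} {Param : Type w}

/-- The initial predicate. -/
def Init (S : TSpec Var Val Act Param) (s : TState Var Val) : Prop :=
  ∀ c ∈ S.init, c.holds s

/-- The next-state relation. -/
def Next (S : TSpec Var Val Act Param) (s s' : TState Var Val) : Prop :=
  ∃ d : Param, ∃ A ∈ S.acts, (S.body A).Holds d s s'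

/-- The behaviors that satisfy `Init ∧ □[Next]_vars`. -/
def behaviors (S : TSpec Var Val Act Param) : Set (Behavior Var Val) :=
  {σ | S.Init (σ 0) ∧
    ∀ i, S.Next (σ i) (σ (i + 1)) ∨ ∀ x ∈ S.vars, σ (i + 1) x = σ i x}

/-- The syntactic conditions on a specification: only declared variables occur in it, and every
action deals with every declared variable, be it in a conjunct or in the frame condition
`UNCHANGED`. -/
structure WellFormed (S : TSpec Var Val Act Param) : Prop where
  init_declared : ∀ c ∈ S.init, c.vars ⊆ S.vars
  conj_declared : ∀ A ∈ S.acts, ∀ c ∈ (S.body A).conj, c.vars ⊆ S.vars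
  unch_declared : ∀ A ∈ S.acts, (S.body A).unch ⊆ S.vars
  frame : ∀ A ∈ S.acts, ∀ x ∈ S.vars,
    x ∈ (S.body A).unch ∨ ∃ c ∈ (S.body A).conj, x ∈ c.vars

open scoped Classical in
/-- Parallel composition of specifications: synchronize on common action names, interleave on the
others. -/
noncomputable def par (S T : TSpec Var Val Act Param) : TSpec Var Val Act Param where
  vars := S.vars ∪ T.vars
  init := S.init ++ T.init
  acts := S.acts ∪ T.acts
  body A :=
    if A ∈ S.acts then
      if A ∈ T.acts then
        { conj := (S.body A).conj ++ (T.body A).conj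
          unch := (S.body A).unch ∪ (T.body A).unch }
      else
        { conj := (S.body A).conj
          unch := (S.body A).unch ∪ T.vars }
    else
      { conj := (T.body A).conj
        unch := (T.body A).unch ∪ S.vars }

/-- Parallel composition of a list of specifications. -/
noncomputable def parList : List (TSpec Var Val Act Param) → TSpec Var Val Act Param
  | [] => { vars := ∅, init := [], acts := ∅, body := fun _ => { conj := [], unch := ∅ } }
  | [S] => S
  | S :: T :: L => S.par (parList (T :: L))

end TSpec

/-! ## Properties -/

/-- A temporal property: a set of behaviors with the finite set of the variables that occur in the
formula. As for every TLA formula, membership depends only on the values of these variables, and is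
invariant under stuttering (finite repetition of states). -/
structure TProperty (Var Val : Type u) where
  vars : Finset Var
  behaviors : Set (Behavior Var Val)
  depends : ∀ σ τ : Behavior Var Val, (∀ n, ∀ x ∈ vars, σ n x = τ n x) →
    (σ ∈ behaviors ↔ τ ∈ behaviors)
  stutter : ∀ (σ : Behavior Var Val) (f : ℕ → ℕ), Monotone f → Function.Surjective f →
    (σ ∘ f ∈ behaviors ↔ σ ∈ behaviors)

/-- `P` is a safety property: every behavior that violates `P` has a finite prefix all of whose
infinite extensions violate `P`. -/
def TProperty.IsSafety {Var Val : Type u} (P : TProperty Var Val) : Prop :=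
  ∀ σ ∉ P.behaviors, ∃ n : ℕ, ∀ τ : Behavior Var Val, (∀ i < n, τ i = σ i) → τ ∉ P.behaviors

/-- `S ⊨ P`. -/
def TSpec.Satisfies {Var Val : Type u} {Act : Type v} {Param : Type w}
    (S : TSpec Var Val Act Param) (P : TProperty Var Val) : Prop :=
  S.behaviors ⊆ P.behaviors

/-! ## Labeled transition systems -/

/-- Labeled transition systems over a universe `Lab` of labels. `err` is the set of states that are
the error state `π`: it is empty for an ordinary LTS, and in a composition every tuple with a
component `π` counts as `π`. -/
structure LTS (Lab : Type v) where
  Q : Type u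
  alphabet : Set Lab
  δ : Q → Lab → Q → Prop
  init : Set Q
  err : Set Q

namespace LTS

variable {Lab : Type v}

/-- Reachable states. -/
inductive Reach (M : LTS.{u, v} Lab) : M.Q → Prop
  | init {q : M.Q} : q ∈ M.init → Reach M q
  | step {q : M.Q} {a : Lab} {q' : M.Q} : Reach M q → a ∈ M.alphabet → M.δ q a q' → Reach M q'

/-- The error state `π` is reachable. -/
def ErrReachable (M : LTS.{u, v} Lab) : Prop := ∃ q, M.Reach q ∧ q ∈ M.err

/-- There are finitely many reachable states, so that the explicit construction of the state graph
terminates. -/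
def FiniteState (M : LTS.{u, v} Lab) : Prop := {q | M.Reach q}.Finite

/-- Parallel composition: synchronize on common labels, interleave on the others. -/
def par (M N : LTS.{u, v} Lab) : LTS.{u, v} Lab where
  Q := M.Q × N.Q
  alphabet := M.alphabet ∪ N.alphabet
  δ p a p' :=
    (a ∈ M.alphabet ∧ a ∈ N.alphabet ∧ M.δ p.1 a p'.1 ∧ N.δ p.2 a p'.2) ∨
    (a ∈ M.alphabet ∧ a ∉ N.alphabet ∧ M.δ p.1 a p'.1 ∧ p'.2 = p.2) ∨
    (a ∉ M.alphabet ∧ a ∈ N.alphabet ∧ p'.1 = p.1 ∧ N.δ p.2 a p'.2)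
  init := {p | p.1 ∈ M.init ∧ p.2 ∈ N.init}
  err := {p | p.1 ∈ M.err ∨ p.2 ∈ N.err}

/-- Bisimulations on `M` that respect the error state. As there are no silent labels, observational
equivalence is strong bisimilarity. -/
def IsBisimulation (M : LTS.{u, v} Lab) (R : M.Q → M.Q → Prop) : Prop :=
  ∀ p q, R p q → (p ∈ M.err ↔ q ∈ M.err) ∧
    (∀ a ∈ M.alphabet, ∀ p', M.δ p a p' → ∃ q', M.δ q a q' ∧ R p' q') ∧
    (∀ a ∈ M.alphabet, ∀ q', M.δ q a q' → ∃ p', M.δ p a p' ∧ R p' q')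

/-- Observational equivalence of states. -/
def Bisimilar (M : LTS.{u, v} Lab) (p q : M.Q) : Prop := ∃ R, M.IsBisimulation R ∧ R p q

theorem bisimilar_equivalence (M : LTS.{u, v} Lab) : Equivalence M.Bisimilar := by
  refine ⟨fun p => ⟨Eq, ?_, rfl⟩, ?_, ?_⟩
  · rintro p q rfl
    exact ⟨Iff.rfl, fun a _ p' h => ⟨p', h, rfl⟩, fun a _ p' h => ⟨p', h, rfl⟩⟩
  · rintro p q ⟨R, hR, h⟩
    refine ⟨fun x y => R y x, fun x y hxy => ?_, h⟩
    obtain ⟨h1, h2, h3⟩ := hR y x hxy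
    exact ⟨h1.symm, h3, h2⟩
  · rintro p q r ⟨R, hR, h⟩ ⟨R', hR', h'⟩
    refine ⟨fun x z => ∃ y, R x y ∧ R' y z, ?_, ⟨q, h, h'⟩⟩
    rintro x z ⟨y, hxy, hyz⟩
    obtain ⟨h1, h2, h3⟩ := hR x y hxy
    obtain ⟨k1, k2, k3⟩ := hR' y z hyz
    refine ⟨h1.trans k1, fun a ha p' hp => ?_, fun a ha p' hp => ?_⟩
    · obtain ⟨y', hy, r1⟩ := h2 a ha p' hp
      obtain ⟨z', hz, r2⟩ := k2 a ha y' hy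
      exact ⟨z', hz, y', r1, r2⟩
    · obtain ⟨y', hy, r1⟩ := k3 a ha p' hp
      obtain ⟨z', hz, r2⟩ := h3 a ha y' hy
      exact ⟨z', hz, y', r2, r1⟩

/-- Observational equivalence on the reachable states. -/
def minSetoid (M : LTS.{u, v} Lab) : Setoid {q : M.Q // M.Reach q} where
  r p q := M.Bisimilar p.1 q.1
  iseqv := ⟨fun _ => M.bisimilar_equivalence.refl _, fun h => M.bisimilar_equivalence.symm h,
    fun h h' => M.bisimilar_equivalence.trans h h'⟩

/-- Minimization with respect to observational equivalence: the quotient of the reachable part. -/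
def min (M : LTS.{u, v} Lab) : LTS.{u, v} Lab where
  Q := Quotient M.minSetoid
  alphabet := M.alphabet
  δ x a y := ∃ p q : {q : M.Q // M.Reach q},
    x = Quotient.mk M.minSetoid p ∧ y = Quotient.mk M.minSetoid q ∧ M.δ p.1 a q.1
  init := {x | ∃ p : {q : M.Q // M.Reach q}, x = Quotient.mk M.minSetoid p ∧ p.1 ∈ M.init}
  err := {x | ∃ p : {q : M.Q // M.Reach q}, x = Quotient.mk M.minSetoid p ∧ p.1 ∈ M.err}

end LTS

/-! ## From specifications to labeled transition systems -/

section ToLTS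

variable {Var Val : Type u} {Act : Type v} {Param : Type w}

/-- The assignments to the variables of `S`. -/
abbrev TSpec.LocalState (S : TSpec Var Val Act Param) : Type u := {x // x ∈ S.vars} → Val

/-- The restriction of a state to the variables of `S`. -/
def TSpec.restrict (S : TSpec Var Val Act Param) (s : TState Var Val) : S.LocalState :=
  fun x => s x.1

/-- The concrete actions `A(d)`. -/
def TSpec.concreteActs (S : TSpec Var Val Act Param) : Set (Act × Param) :=
  {a | a.1 ∈ S.acts}

/-- The state graph of `S`, whose edges are labeled with the concrete actions. -/
def TSpec.toLTS (S : TSpec Var Val Act Param) : LTS.{u, max v w} (Act × Param) where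
  Q := S.LocalState
  alphabet := S.concreteActs
  δ q a q' := a ∈ S.concreteActs ∧ ∃ s s' : TState Var Val,
    q = S.restrict s ∧ q' = S.restrict s' ∧ (S.body a.1).Holds a.2 s s'
  init := {q | ∃ s, q = S.restrict s ∧ S.Init s}
  err := ∅

/-- The behavior `s, τ 0, τ 1, …`. -/
def Behavior.cons (s : TState Var Val) (τ : Behavior Var Val) : Behavior Var Val
  | 0 => s
  | n + 1 => τ n

/-- What remains to be satisfied of the obligation `R` after the state `s`. -/
def residualObl (s : TState Var Val) (R : Set (Behavior Var Val)) : Set (Behavior Var Val) :=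
  {τ | Behavior.cons s τ ∈ R}

open scoped Classical in
/-- The state of the error LTS reached with the state `s` and the remaining obligation `R`:
it is `π` (represented by `none`) when no continuation meets `R`, i.e. when the history is a bad
prefix of the property. -/
noncomputable def TSpec.errState (S : TSpec Var Val Act Param) (s : TState Var Val)
    (R : Set (Behavior Var Val)) : Option (S.LocalState × Set (Behavior Var Val)) :=
  if R = ∅ then none else some (S.restrict s, R)

/-- The error LTS of `S` and a safety property `P`: the state graph of `S`, in which each state also
records what remains to be satisfied of `P`, and in which the violations of `P` lead to the sink
`π`. For an invariant `P` what remains is always `P` itself, so that this is the state graph with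
the states that violate the invariant replaced with `π`. -/
noncomputable def TSpec.errLTS (S : TSpec Var Val Act Param) (P : TProperty Var Val) :
    LTS.{u, max v w} (Act × Param) where
  Q := Option (S.LocalState × Set (Behavior Var Val))
  alphabet := S.concreteActs
  δ x a y := a ∈ S.concreteActs ∧ ∃ (s s' : TState Var Val) (R : Set (Behavior Var Val)),
    x = some (S.restrict s, R) ∧ y = S.errState s' (residualObl s' R) ∧ (S.body a.1).Holds a.2 s s'
  init := {x | ∃ s, x = S.errState s (residualObl s P.behaviors) ∧ S.Init s}
  err := {none}

end ToLTS

/-! ## Decomposition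

The algorithms that may make nondeterministic choices or fail to terminate are given by their
input-output relation: the relation holds if some run terminates with that output. -/

section Decompose

variable {Var Val : Type u} {Act : Type v} {Param : Type w}

open scoped Classical in
/-- Restriction of the conjunctions and frame conditions of `S` to the conjuncts and variables
within `V`. An action all of whose conjuncts are removed is deleted. -/
noncomputable def TSpec.slice (S : TSpec Var Val Act Param) (V : Finset Var) :
    TSpec Var Val Act Param where
  vars := S.vars ∩ V
  init := S.init.filter (fun c => c.vars ⊆ V)
  acts := S.acts.filter (fun A => ∃ c ∈ (S.body A).conj, c.vars ⊆ V)
  body A :=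
    { conj := (S.body A).conj.filter (fun c => c.vars ⊆ V)
      unch := (S.body A).unch ∩ V }

/-- The sets of variables of the conjuncts of `S` (of its initial predicate and of its actions). -/
def TSpec.conjVars (S : TSpec Var Val Act Param) : Set (Finset Var) :=
  {W | (∃ c ∈ S.init, W = c.vars) ∨ ∃ A ∈ S.acts, ∃ c ∈ (S.body A).conj, W = c.vars}

/-- The variables that occur together with a variable of `V` in some conjunct of `S`. -/
def TSpec.occurs (S : TSpec Var Val Act Param) (V : Set Var) : Set Var :=
  {x | ∃ W ∈ S.conjVars, (∃ y ∈ W, y ∈ V) ∧ x ∈ W}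

/-- The procedure that accumulates `op` from `X` on until a fixpoint is reached:
`Fixpoint op X Z` if it terminates with output `Z`. -/
inductive Fixpoint (op : Set Var → Set Var) : Set Var → Set Var → Prop
  | done {X : Set Var} : X = X ∪ op X → Fixpoint op X X
  | step {X Z : Set Var} : X ≠ X ∪ op X → Fixpoint op (X ∪ op X) Z →
      Fixpoint op X ((X ∪ op X) ∪ Z)

open scoped Classical in
/-- `PartitionVars T V` returns `(VC, VT)`. -/
def PartitionVars (T : TSpec Var Val Act Param) (V VC VT : Finset Var) : Prop :=
  Fixpoint T.occurs (V : Set Var) (VC : Set Var) ∧ VT = T.vars \ VC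

/-- The loop of the decomposition algorithm, from the specification `T` and the partition
`(VC, VT)` of its variables on, produces the `n + 1` components `C`. -/
inductive DecomposeLoop : TSpec Var Val Act Param → Finset Var → Finset Var →
    (n : ℕ) → (Fin (n + 1) → TSpec Var Val Act Param) → Prop
  | done {T : TSpec Var Val Act Param} {VC : Finset Var} :
      DecomposeLoop T VC ∅ 0 (fun _ => T)
  | step {T : TSpec Var Val Act Param} {VC VT : Finset Var} {x : Var} {VC' VT' : Finset Var}
      {n : ℕ} {C : Fin (n + 1) → TSpec Var Val Act Param} :
      VT ≠ ∅ → x ∈ (T.slice VT).vars → PartitionVars (T.slice VT) {x} VC' VT' →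
      DecomposeLoop (T.slice VT) VC' VT' n C →
      DecomposeLoop T VC VT (n + 1) (Fin.cons (T.slice VC) C)

/-- The decomposition of `S` with respect to `P` can produce the `n + 1` components
`C 0, …, C n`. -/
def Decompose (S : TSpec Var Val Act Param) (P : TProperty Var Val) (n : ℕ)
    (C : Fin (n + 1) → TSpec Var Val Act Param) : Prop :=
  ∃ VC VT : Finset Var, PartitionVars S P.vars VC VT ∧ DecomposeLoop S VC VT n C

end Decompose

/-! ## Recomposition -/

/-- A (partial) recomposition map for `n + 1` components: a surjection `f` from a set `dom` of
components that contains the first one onto `{d_P, d_1, …, d_m}` that sends the first component to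
`d_P`. Here `none` is `d_P`, and `some j` is `d_{j+1}`. -/
structure RecompMap (n : ℕ) where
  dom : Set (Fin (n + 1))
  m : ℕ
  f : dom → Option (Fin m)
  surj : Function.Surjective f
  first_mem : 0 ∈ dom
  first : f ⟨0, first_mem⟩ = none

/-- A recomposition strategy chooses a total recomposition map for every family of components. -/
abbrev RecompStrategy (Var Val : Type u) (Act : Type v) (Param : Type w) : Type _ :=
  ∀ n : ℕ, (Fin (n + 1) → TSpec Var Val Act Param) → {F : RecompMap n // F.dom = Set.univ}

section Recompose

variable {Var Val : Type u} {Act : Type v} {Param : Type w} {n : ℕ}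

/-- The sets `X_k`: `X_0` holds the first component only, and `X_{k+1}` holds the components that
share an action name with a component in `X_k`. -/
def reductionSets (C : Fin (n + 1) → TSpec Var Val Act Param) : ℕ → Set (Fin (n + 1))
  | 0 => {0}
  | k + 1 => {j | ∃ i ∈ reductionSets C k, ∃ A, A ∈ (C j).acts ∧ A ∈ (C i).acts}

/-- The necessary components. -/
def necessary (C : Fin (n + 1) → TSpec Var Val Act Param) : Set (Fin (n + 1)) :=
  ⋃ k, reductionSets C k

theorem zero_mem_necessary (C : Fin (n + 1) → TSpec Var Val Act Param) : 0 ∈ necessary C :=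
  Set.mem_iUnion.2 ⟨0, rfl⟩

open scoped Classical in
/-- The indices `j` such that some necessary component is sent to `d_j`. -/
noncomputable def keptIndices (C : Fin (n + 1) → TSpec Var Val Act Param) (F : RecompMap n) :
    Finset (Fin F.m) :=
  Finset.univ.filter (fun j => ∃ i : F.dom, i.1 ∈ necessary C ∧ F.f i = some j)

/-- Static reduction: restrict the domain to the necessary components, and drop the `d_j` that are
no longer attained; the others are renumbered in the same order. -/
noncomputable def staticReduce (C : Fin (n + 1) → TSpec Var Val Act Param) (F : RecompMap n) :
    RecompMap n where
  dom := F.dom ∩ necessary C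
  m := (keptIndices C F).card
  f i := (F.f ⟨i.1, i.2.1⟩).pmap
    (fun j hj => ((keptIndices C F).orderIsoOfFin rfl).symm ⟨j, hj⟩)
    (fun j hj => by
      simp only [keptIndices, Finset.mem_filter, Finset.mem_univ, true_and]
      exact ⟨⟨i.1, i.2.1⟩, i.2.2, hj⟩)
  surj := by
    rintro (_ | k)
    · exact ⟨⟨0, F.first_mem, zero_mem_necessary C⟩, by simp [F.first]⟩
    · have hk := ((keptIndices C F).orderIsoOfFin rfl k).2
      obtain ⟨i, hi, hik⟩ : ∃ i : F.dom, i.1 ∈ necessary C ∧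
          F.f i = some ((keptIndices C F).orderIsoOfFin rfl k).1 := by
        have hk' := hk
        simp only [keptIndices, Finset.mem_filter, Finset.mem_univ, true_and] at hk'
        exact hk'
      exact ⟨⟨i.1, i.2, hi⟩, by
        simp only [hik, Option.pmap_some]
        exact congrArg some (((keptIndices C F).orderIsoOfFin rfl).symm_apply_apply k)⟩
  first_mem := ⟨F.first_mem, zero_mem_necessary C⟩
  first := by simp [F.first]

open scoped Classical in
/-- The parallel composition of the components that are sent to `d`. -/
noncomputable def recompose (C : Fin (n + 1) → TSpec Var Val Act Param) (F : RecompMap n)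
    (d : Option (Fin F.m)) : TSpec Var Val Act Param :=
  TSpec.parList
    (((List.finRange (n + 1)).filter (fun i => ∃ h : i ∈ F.dom, F.f ⟨i, h⟩ = d)).map C)

end Recompose

/-! ## Verification -/

section Verify

variable {Var Val : Type u} {Act : Type v} {Param : Type w}

/-- The remaining part of the compositional verification, with current LTS `M` and the list of the
components still to be composed. The construction of the LTS of a component terminates only if that
LTS has finitely many reachable states. -/
inductive CompVerifyLoop : LTS.{u, max v w} (Act × Param) → List (TSpec Var Val Act Param) →
    Bool → Prop
  | success {M : LTS.{u, max v w} (Act × Param)} {Ds : List (TSpec Var Val Act Param)} :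
      ¬ M.ErrReachable → CompVerifyLoop M Ds true
  | failure {M : LTS.{u, max v w} (Act × Param)} :
      M.ErrReachable → CompVerifyLoop M [] false
  | next {M : LTS.{u, max v w} (Act × Param)} {D : TSpec Var Val Act Param}
      {Ds : List (TSpec Var Val Act Param)} {b : Bool} :
      M.ErrReachable → D.toLTS.FiniteState → CompVerifyLoop (M.par D.toLTS.min) Ds b →
      CompVerifyLoop M (D :: Ds) b

/-- Compositional verification terminates with output `b`. -/
def CompVerify (Ds : List (TSpec Var Val Act Param)) (DP : TSpec Var Val Act Param)
    (P : TProperty Var Val) (b : Bool) : Prop :=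
  (DP.errLTS P).FiniteState ∧ CompVerifyLoop (DP.errLTS P).min Ds b

/-- Some run of the algorithm Recomp-Verify on the specification `S`, the property `P` and the
recomposition strategy `ρ` terminates with output `b`. -/
def RecompVerify (S : TSpec Var Val Act Param) (P : TProperty Var Val)
    (ρ : RecompStrategy Var Val Act Param) (b : Bool) : Prop :=
  ∃ (n : ℕ) (C : Fin (n + 1) → TSpec Var Val Act Param) (F : RecompMap n),
    Decompose S P n C ∧ F = staticReduce C (ρ n C).1 ∧
    CompVerify ((List.finRange F.m).map (fun j => recompose C F (some j)))
      (recompose C F none) P b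

end Verify

/-! The two directions rest on different approximations. For the answer true, every component, and
so every recomposed part, is weaker than `S`. Hence each LTS that the algorithm builds can follow
any history of `S` until it meets the error state (`LTS.Follows`). This survives minimization and
composition, however many parts are still missing. If `S` violates the safety property `P`, some
finite history leaves an empty obligation (`exists_config_empty`), so `π` is reachable at every
stage and true is never returned.

For the answer false, the composed LTS is simulated by the error LTS of one specification, the
composition of the parts used so far (`errLTS_par_sim`). Since the parts have disjoint variables,
their local states glue to a single state. At the end these parts are exactly the necessary
components, which share no action name with the others. An error path therefore lifts to a history
of `S` in which the other components keep values taken from a global initial state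
(`not_satisfies_of_errReachable`). Stuttering forever after it gives a behavior of `S` that violates
`P`.

Both directions need the components to make up `S` exactly. A variable set closed under joint
occurrence splits the conjuncts in two, and the frame assumption makes a deleted action leave the
variables of the slice unchanged (`slice_steps_iff`). `Steps`, which reads a foreign action as a
stuttering step, turns parallel composition into plain conjunction. -/

/-! ### Simulations -/

namespace LTS

variable {Lab : Type v}

/-- `M.Sim N`: `N` simulates `M` until `N` reaches the error state. -/
def Sim (M N : LTS.{u, v} Lab) : Prop :=
  M.alphabet = N.alphabet ∧ ∃ R : M.Q → N.Q → Prop,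
    (∀ p ∈ M.init, ∃ q ∈ N.init, R p q) ∧
    ∀ p q, R p q → (p ∈ M.err → q ∈ N.err) ∧
      ∀ a ∈ M.alphabet, ∀ p', M.δ p a p' → q ∈ N.err ∨ ∃ q', N.δ q a q' ∧ R p' q'

theorem Sim.trans {M N K : LTS.{u, v} Lab} (h : M.Sim N) (k : N.Sim K) : M.Sim K := by
  obtain ⟨ha, R, hi, hR⟩ := h
  obtain ⟨ka, T, ki, hT⟩ := k
  refine ⟨ha.trans ka, fun p r => ∃ q, R p q ∧ T q r, fun p hp => ?_, ?_⟩
  · obtain ⟨q, hq, h1⟩ := hi p hp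
    obtain ⟨r, hr, h2⟩ := ki q hq
    exact ⟨r, hr, q, h1, h2⟩
  · rintro p r ⟨q, h1, h2⟩
    refine ⟨fun hp => (hT q r h2).1 ((hR p q h1).1 hp), fun a haM p' hp' => ?_⟩
    rcases (hR p q h1).2 a haM p' hp' with hq | ⟨q', hq', h1'⟩
    · exact Or.inl ((hT q r h2).1 hq)
    · rcases (hT q r h2).2 a (ha ▸ haM) q' hq' with hr | ⟨r', hr', h2'⟩
      · exact Or.inl hr
      · exact Or.inr ⟨r', hr', q', h1', h2'⟩

theorem Sim.par {M M' N N' : LTS.{u, v} Lab} (h : M.Sim M') (k : N.Sim N') :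
    (M.par N).Sim (M'.par N') := by
  obtain ⟨ha, R, hi, hR⟩ := h
  obtain ⟨ka, T, ki, hT⟩ := k
  refine ⟨by simp only [LTS.par, ha, ka], fun p q => R p.1 q.1 ∧ T p.2 q.2, fun p hp => ?_, ?_⟩
  · obtain ⟨q1, hq1, h1⟩ := hi p.1 hp.1
    obtain ⟨q2, hq2, h2⟩ := ki p.2 hp.2
    exact ⟨(q1, q2), ⟨hq1, hq2⟩, h1, h2⟩
  · rintro p q ⟨h1, h2⟩
    refine ⟨Or.imp (hR _ _ h1).1 (hT _ _ h2).1, fun a _ p' hp' => ?_⟩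
    rcases hp' with ⟨aM, aN, d1, d2⟩ | ⟨aM, aN, d1, d2⟩ | ⟨aM, aN, d1, d2⟩
    · rcases (hR _ _ h1).2 a aM _ d1 with e | ⟨q1, e1, r1⟩
      · exact Or.inl (Or.inl e)
      rcases (hT _ _ h2).2 a aN _ d2 with e | ⟨q2, e2, r2⟩
      · exact Or.inl (Or.inr e)
      exact Or.inr ⟨(q1, q2), Or.inl ⟨ha ▸ aM, ka ▸ aN, e1, e2⟩, r1, r2⟩
    · rcases (hR _ _ h1).2 a aM _ d1 with e | ⟨q1, e1, r1⟩
      · exact Or.inl (Or.inl e)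
      exact Or.inr ⟨(q1, q.2), Or.inr (Or.inl ⟨ha ▸ aM, ka ▸ aN, e1, rfl⟩), r1, d2 ▸ h2⟩
    · rcases (hT _ _ h2).2 a aN _ d2 with e | ⟨q2, e2, r2⟩
      · exact Or.inl (Or.inr e)
      exact Or.inr ⟨(q.1, q2), Or.inr (Or.inr ⟨ha ▸ aM, ka ▸ aN, rfl, e2⟩), d1 ▸ h1, r2⟩

/-- A path of `M` is matched step by step; if the matching stops early, it does so because `N` is
already in an error state. -/
theorem Sim.errReachable {M N : LTS.{u, v} Lab} (h : M.Sim N) (hM : M.ErrReachable) :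
    N.ErrReachable := by
  obtain ⟨ha, R, hi, hR⟩ := h
  obtain ⟨p, hp, hpe⟩ := hM
  have key : N.ErrReachable ∨ ∃ q, N.Reach q ∧ R p q := by
    clear hpe
    induction hp with
    | init h0 =>
      obtain ⟨q, hq, h1⟩ := hi _ h0
      exact Or.inr ⟨q, .init hq, h1⟩
    | step _ haM hδ ih =>
      rcases ih with h | ⟨q, hq, h1⟩
      · exact Or.inl h
      · rcases (hR _ _ h1).2 _ haM _ hδ with e | ⟨q', hq', h1'⟩
        · exact Or.inl ⟨q, hq, e⟩
        · exact Or.inr ⟨q', .step hq (ha ▸ haM) hq', h1'⟩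
  rcases key with h | ⟨q, hq, h1⟩
  · exact h
  · exact ⟨q, hq, (hR _ _ h1).1 hpe⟩

/-! ### Minimization and simulation -/

theorem Bisimilar.err_iff {M : LTS.{u, v} Lab} {p q : M.Q} (h : M.Bisimilar p q) :
    p ∈ M.err ↔ q ∈ M.err := by
  obtain ⟨R, hR, h⟩ := h
  exact (hR _ _ h).1

theorem Bisimilar.exists_step {M : LTS.{u, v} Lab} {p q p' : M.Q} {a : Lab}
    (h : M.Bisimilar p q) (ha : a ∈ M.alphabet) (hp : M.δ p a p') :
    ∃ q', M.δ q a q' ∧ M.Bisimilar p' q' := by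
  obtain ⟨R, hR, h⟩ := h
  obtain ⟨q', hq, h'⟩ := (hR _ _ h).2.1 a ha p' hp
  exact ⟨q', hq, R, hR, h'⟩

theorem sim_min (M : LTS.{u, v} Lab) : M.Sim M.min := by
  refine ⟨rfl, fun p x => ∃ h : M.Reach p, x = Quotient.mk M.minSetoid ⟨p, h⟩,
    fun p hp => ⟨_, ⟨⟨p, .init hp⟩, rfl, hp⟩, .init hp, rfl⟩, ?_⟩
  rintro p _ ⟨h, rfl⟩
  refine ⟨fun hp => ⟨⟨p, h⟩, rfl, hp⟩, fun a ha p' hp' => Or.inr ⟨_, ⟨⟨p, h⟩, ⟨p', h.step ha hp'⟩,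
    rfl, rfl, hp'⟩, h.step ha hp', rfl⟩⟩

/-- An edge between classes starts at some representative; bisimilarity transfers it to whichever
reachable member of the class is being tracked. -/
theorem min_sim (M : LTS.{u, v} Lab) : M.min.Sim M := by
  refine ⟨rfl, fun x p => ∃ h : M.Reach p, x = Quotient.mk M.minSetoid ⟨p, h⟩, ?_, ?_⟩
  · rintro _ ⟨p, rfl, hp⟩
    exact ⟨p.1, hp, p.2, rfl⟩
  · rintro _ p ⟨h, rfl⟩
    constructor
    · rintro ⟨r, hr, hre⟩
      have hb : M.Bisimilar p r.1 := Quotient.exact hr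
      exact hb.err_iff.2 hre
    · rintro a ha _ ⟨r, r', hr, rfl, hδ⟩
      have hb : M.Bisimilar r.1 p := Quotient.exact hr.symm
      obtain ⟨p', hp', hb'⟩ := hb.exists_step ha hδ
      exact Or.inr ⟨p', hp', h.step ha hp', Quotient.sound hb'⟩

end LTS

/-! ### Residual obligations -/

section Residual

variable {Var Val : Type u}

theorem Behavior.cons_comp_pred (s : TState Var Val) (τ : Behavior Var Val) :
    Behavior.cons s τ ∘ Nat.pred = Behavior.cons s (Behavior.cons s τ) := by
  funext n
  cases n <;> rfl

/-- What remains of a property after the state `s`, as a property. -/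
def TProperty.after (P : TProperty Var Val) (s : TState Var Val) : TProperty Var Val where
  vars := P.vars
  behaviors := residualObl s P.behaviors
  depends σ τ h := P.depends _ _ (by rintro (_ | n) x hx; exacts [rfl, h n x hx])
  stutter σ f hf hs := by
    -- `g` is `f` shifted by one: it fixes the prepended state and repeats the later states as `f`
    -- does.
    let g : ℕ → ℕ := fun n => Nat.casesOn n 0 (fun k => f k + 1)
    have hg : Monotone g := monotone_nat_of_le_succ (by
      rintro (_ | n)
      · exact Nat.zero_le _
      · exact Nat.succ_le_succ (hf (Nat.le_succ n)))
    have hgs : Function.Surjective g := by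
      rintro (_ | m)
      · exact ⟨0, rfl⟩
      · obtain ⟨k, hk⟩ := hs m
        exact ⟨k + 1, congrArg Nat.succ hk⟩
    have h : Behavior.cons s σ ∘ g = Behavior.cons s (σ ∘ f) := by
      funext n
      cases n <;> rfl
    have := P.stutter (Behavior.cons s σ) g hg hgs
    rw [h] at this
    exact this

theorem TProperty.residualObl_congr (P : TProperty Var Val) {s t : TState Var Val}
    (h : ∀ x ∈ P.vars, s x = t x) : residualObl s P.behaviors = residualObl t P.behaviors := by
  ext τ
  exact P.depends _ _ (by rintro (_ | n) x hx; exacts [h x hx, rfl])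

/-- Reading the same state twice is a stutter of reading it once, along `Nat.pred`. -/
theorem TProperty.residualObl_self (P : TProperty Var Val) (s : TState Var Val) :
    residualObl s (residualObl s P.behaviors) = residualObl s P.behaviors := by
  ext τ
  have := P.stutter (Behavior.cons s τ) Nat.pred (fun _ _ h => Nat.pred_le_pred h)
    (fun n => ⟨n + 1, rfl⟩)
  rw [Behavior.cons_comp_pred] at this
  exact this

/-- `R` is what remains, just after the state `s`, of a property of the variables in `V`. -/
def IsResidual (V : Finset Var) (s : TState Var Val) (R : Set (Behavior Var Val)) : Prop :=
  ∃ Y : TProperty Var Val, Y.vars ⊆ V ∧ R = residualObl s Y.behaviors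

namespace IsResidual

variable {V : Finset Var} {s t t' : TState Var Val} {R : Set (Behavior Var Val)}

theorem next (h : IsResidual V s R) (t : TState Var Val) : IsResidual V t (residualObl t R) := by
  obtain ⟨Y, hY, rfl⟩ := h
  exact ⟨Y.after s, hY, rfl⟩

theorem congr (h : IsResidual V s R) (ht : ∀ x ∈ V, t x = t' x) :
    residualObl t R = residualObl t' R := by
  obtain ⟨Y, hY, rfl⟩ := h
  exact (Y.after s).residualObl_congr fun x hx => ht x (hY hx)

/-- Stuttering invariance is used here: a step that does not touch `V` leaves the recorded
obligation alone. It matters that `R` has already consumed `s`. -/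
theorem stutter (h : IsResidual V s R) (ht : ∀ x ∈ V, t x = s x) : residualObl t R = R := by
  rw [h.congr ht]
  obtain ⟨Y, hY, rfl⟩ := h
  exact Y.residualObl_self s

theorem mono {W : Finset Var} (h : IsResidual V s R) (hW : V ⊆ W) : IsResidual W s R := by
  obtain ⟨Y, hY, rfl⟩ := h
  exact ⟨Y, hY.trans hW, rfl⟩

end IsResidual

end Residual

/-! ### Reachable configurations of a specification -/

section Config

variable {Var Val : Type u} {Act : Type v} {Param : Type w}

namespace TSpec

/-- A step of `S` that may be a stuttering step. -/
def StepOrStutter (S : TSpec Var Val Act Param) (s s' : TState Var Val) : Prop :=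
  S.Next s s' ∨ ∀ x ∈ S.vars, s' x = s x

/-- The final states of the finite histories of `S`, with what remains to be satisfied of `P`. -/
inductive Config (S : TSpec Var Val Act Param) (P : TProperty Var Val) :
    TState Var Val → Set (Behavior Var Val) → Prop
  | init {s : TState Var Val} : S.Init s → Config S P s (residualObl s P.behaviors)
  | step {s s' : TState Var Val} {R : Set (Behavior Var Val)} : Config S P s R →
      S.StepOrStutter s s' → Config S P s' (residualObl s' R)

variable {S : TSpec Var Val Act Param} {P : TProperty Var Val}

theorem Config.isResidual {s : TState Var Val} {R : Set (Behavior Var Val)}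
    (h : S.Config P s R) : IsResidual P.vars s R := by
  induction h with
  | init _ => exact ⟨P, subset_rfl, rfl⟩
  | step _ _ ih => exact ih.next _

/-- A continuation of the history by steps of `S` completes it to a behavior of `S`; the induction
peels the history off from its end. -/
theorem Config.mem_of_satisfies (hS : S.Satisfies P) {s : TState Var Val}
    {R : Set (Behavior Var Val)} (h : S.Config P s R) :
    ∀ τ : Behavior Var Val,
      (∀ i, S.StepOrStutter (Behavior.cons s τ i) (Behavior.cons s τ (i + 1))) → τ ∈ R := by
  induction h with
  | init h0 => exact fun τ hτ => hS ⟨h0, hτ⟩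
  | @step s s' R _ hstep ih =>
    intro τ hτ
    refine ih (Behavior.cons s' τ) ?_
    rintro (_ | i)
    exacts [hstep, hτ i]

/-- The constant continuation is always allowed by `□[Next]_vars`, yet it cannot meet an empty
obligation. -/
theorem Config.not_satisfies {s : TState Var Val} (h : S.Config P s ∅) : ¬ S.Satisfies P := by
  intro hS
  refine h.mem_of_satisfies hS (fun _ => s) fun i => Or.inr fun x _ => ?_
  cases i <;> rfl

theorem exists_config_empty (hP : P.IsSafety) (h : ¬ S.Satisfies P) :
    ∃ s, S.Config P s ∅ := by
  obtain ⟨σ, hσ, hσP⟩ := Set.not_subset.1 h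
  obtain ⟨n, hn⟩ := hP σ hσP
  -- Whatever meets the obligation left after `σ 0, …, σ k` is the tail of a behavior in `P` that
  -- begins with these states.
  have key : ∀ k, ∃ R, S.Config P (σ k) R ∧ ∀ τ ∈ R, ∃ ρ ∈ P.behaviors,
      (∀ i ≤ k, ρ i = σ i) ∧ ∀ j, ρ (k + 1 + j) = τ j := by
    intro k
    induction k with
    | zero =>
      refine ⟨_, .init hσ.1, fun τ hτ => ⟨_, hτ, fun i hi => ?_, fun j => ?_⟩⟩
      · obtain rfl : i = 0 := by omega
        rfl
      · rw [show 0 + 1 + j = j + 1 by omega]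
        rfl
    | succ k ih =>
      obtain ⟨R, hR, h⟩ := ih
      refine ⟨_, hR.step (hσ.2 k), fun τ hτ => ?_⟩
      obtain ⟨ρ, hρ, h1, h2⟩ := h _ hτ
      refine ⟨ρ, hρ, fun i hi => ?_, fun j => ?_⟩
      · rcases Nat.le_succ_iff.1 hi with hi | rfl
        · exact h1 i hi
        · exact h2 0
      · rw [show k + 1 + 1 + j = k + 1 + (j + 1) by omega]
        exact h2 (j + 1)
  -- The bad prefix consists of the states before `n`; taking in `σ n` as well does no harm and
  -- covers `n = 0`.
  obtain ⟨R, hR, h⟩ := key n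
  obtain rfl : R = ∅ := by
    refine Set.eq_empty_of_forall_notMem fun τ hτ => ?_
    obtain ⟨ρ, hρ, h1, -⟩ := h τ hτ
    exact hn ρ (fun i hi => h1 i hi.le) hρ
  exact ⟨_, hR⟩

end TSpec

end Config

/-! ### The joint steps of a specification -/

namespace TSpec

variable {Var Val : Type u} {Act : Type v} {Param : Type w}

/-- What the action `A(d)` of an environment means for `S`: a transition of `S` if `A` is one of its
actions, and otherwise a step that leaves the variables of `S` unchanged. -/
def Steps (S : TSpec Var Val Act Param) (A : Act) (d : Param) (s s' : TState Var Val) : Prop :=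
  (A ∈ S.acts → (S.body A).Holds d s s') ∧ (A ∉ S.acts → ∀ x ∈ S.vars, s' x = s x)

theorem Steps.stepOrStutter {S : TSpec Var Val Act Param} {A : Act} {d : Param}
    {s s' : TState Var Val} (h : S.Steps A d s s') : S.StepOrStutter s s' := by
  by_cases hA : A ∈ S.acts
  · exact Or.inl ⟨d, A, hA, h.1 hA⟩
  · exact Or.inr (h.2 hA)

/-- The meaning of `S` depends only on the variables of `S`. -/
structure IsLocal (S : TSpec Var Val Act Param) : Prop where
  init : ∀ s t : TState Var Val, (∀ x ∈ S.vars, s x = t x) → S.Init s → S.Init t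
  steps : ∀ (A : Act) (d : Param) (s s' t t' : TState Var Val), (∀ x ∈ S.vars, s x = t x) →
    (∀ x ∈ S.vars, s' x = t' x) → S.Steps A d s s' → S.Steps A d t t'

theorem WellFormed.isLocal {S : TSpec Var Val Act Param} (h : S.WellFormed) : S.IsLocal where
  init s t hst hs c hc := (c.depends s t fun x hx => hst x (h.init_declared c hc hx)).1 (hs c hc)
  steps A d s s' t t' hst hst' hs := by
    refine ⟨fun hA => ⟨fun c hc => ?_, fun x hx => ?_⟩, fun hA x hx => ?_⟩
    · have hv := h.conj_declared A hA c hc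
      exact (c.depends d s s' t t' (fun x hx => hst x (hv hx)) fun x hx => hst' x (hv hx)).1
        ((hs.1 hA).1 c hc)
    · have hv := h.unch_declared A hA hx
      rw [← hst x hv, ← hst' x hv]
      exact (hs.1 hA).2 x hx
    · rw [← hst x hx, ← hst' x hx]
      exact hs.2 hA x hx

/-! ### Parallel composition of specifications -/

variable {S T : TSpec Var Val Act Param}

theorem par_init_iff {s : TState Var Val} : (S.par T).Init s ↔ S.Init s ∧ T.Init s := by
  simp only [Init, par, List.mem_append, or_imp, forall_and]

/-- Synchronization and interleaving become one conjunction, because the frame condition that `par`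
adds to an action of one side is what `Steps` asks of the other side. -/
theorem par_steps_iff {A : Act} {d : Param} {s s' : TState Var Val} :
    (S.par T).Steps A d s s' ↔ S.Steps A d s s' ∧ T.Steps A d s s' := by
  classical
  by_cases hS : A ∈ S.acts <;> by_cases hT : A ∈ T.acts <;>
    simp only [Steps, par, ActionDef.Holds, hS, hT, Finset.mem_union, List.mem_append, or_imp,
      forall_and, if_true, if_false, true_imp_iff, false_imp_iff, not_true, not_false_iff,
      or_true, true_or, or_self] <;> tauto

/-- `E` is, up to equivalence, the parallel composition of the components in `I`. -/
structure Represents {ι : Type*} (C : ι → TSpec Var Val Act Param) (I : Set ι)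
    (E : TSpec Var Val Act Param) : Prop where
  mem_vars : ∀ x, x ∈ E.vars ↔ ∃ i ∈ I, x ∈ (C i).vars
  mem_acts : ∀ A, A ∈ E.acts ↔ ∃ i ∈ I, A ∈ (C i).acts
  init_iff : ∀ s, E.Init s ↔ ∀ i ∈ I, (C i).Init s
  steps_iff : ∀ A d s s', E.Steps A d s s' ↔ ∀ i ∈ I, (C i).Steps A d s s'

namespace Represents

variable {ι : Type*} {C : ι → TSpec Var Val Act Param} {I J : Set ι}
  {E F : TSpec Var Val Act Param}

theorem singleton (i : ι) : Represents C {i} (C i) := by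
  constructor <;> simp

theorem par (h : Represents C I E) (k : Represents C J F) : Represents C (I ∪ J) (E.par F) where
  mem_vars x := by
    simp only [TSpec.par, Finset.mem_union, h.mem_vars, k.mem_vars, Set.mem_union, or_and_right,
      exists_or]
  mem_acts x := by
    simp only [TSpec.par, Finset.mem_union, h.mem_acts, k.mem_acts, Set.mem_union, or_and_right,
      exists_or]
  init_iff s := by
    simp only [par_init_iff, h.init_iff, k.init_iff, Set.mem_union, or_imp, forall_and]
  steps_iff A d s s' := by
    simp only [par_steps_iff, h.steps_iff, k.steps_iff, Set.mem_union, or_imp, forall_and]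

theorem parList (C : ι → TSpec Var Val Act Param) :
    ∀ l : List ι, Represents C {i | i ∈ l} (TSpec.parList (l.map C))
  | [] => by
    constructor <;> simp [TSpec.parList, Init, Steps]
  | [i] => by
    have : {j | j ∈ [i]} = {i} := by ext; simp
    rw [this]
    exact singleton i
  | i :: j :: l => by
    have : {k | k ∈ i :: j :: l} = {i} ∪ {k | k ∈ j :: l} := by ext; simp
    rw [this]
    exact (singleton i).par (parList C (j :: l))

theorem vars_subset (h : Represents C I E) {i : ι} (hi : i ∈ I) : (C i).vars ⊆ E.vars :=
  fun x hx => (h.mem_vars x).2 ⟨i, hi, hx⟩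

theorem isLocal (h : Represents C I E) (hC : ∀ i, (C i).IsLocal) : E.IsLocal where
  init s t hst hs := (h.init_iff t).2 fun i hi =>
    (hC i).init s t (fun x hx => hst x (h.vars_subset hi hx)) ((h.init_iff s).1 hs i hi)
  steps A d s s' t t' hst hst' hs := (h.steps_iff A d t t').2 fun i hi =>
    (hC i).steps A d s s' t t' (fun x hx => hst x (h.vars_subset hi hx))
      (fun x hx => hst' x (h.vars_subset hi hx)) ((h.steps_iff A d s s').1 hs i hi)

theorem disjoint_vars (h : Represents C I E) (k : Represents C J F) (hIJ : Disjoint I J)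
    (hC : ∀ i j, i ≠ j → Disjoint (C i).vars (C j).vars) : Disjoint E.vars F.vars := by
  refine Finset.disjoint_left.2 fun x hx hx' => ?_
  obtain ⟨i, hi, hxi⟩ := (h.mem_vars x).1 hx
  obtain ⟨j, hj, hxj⟩ := (k.mem_vars x).1 hx'
  exact Finset.disjoint_left.1 (hC i j (Set.disjoint_iff_forall_ne.1 hIJ hi hj)) hxi hxj

end Represents

/-! ### Slices -/

/-- Every conjunct of `S` in which a variable of `V` occurs contains variables of `V` only. -/
def IsClosed (S : TSpec Var Val Act Param) (V : Finset Var) : Prop :=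
  ∀ W ∈ S.conjVars, (∃ y ∈ W, y ∈ V) → W ⊆ V

theorem WellFormed.subset_vars (h : S.WellFormed) {W : Finset Var} (hW : W ∈ S.conjVars) :
    W ⊆ S.vars := by
  rcases hW with ⟨c, hc, rfl⟩ | ⟨A, hA, c, hc, rfl⟩
  exacts [h.init_declared c hc, h.conj_declared A hA c hc]

-- A conjunct that meets `V` stays inside it by closedness; one that misses `V` lies in the
-- complement because its variables are declared. No conjunct is lost in slicing.
open scoped Classical in
theorem IsClosed.subset_or_subset_sdiff {V W : Finset Var} (hV : S.IsClosed V) (h : S.WellFormed)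
    (hW : W ∈ S.conjVars) : W ⊆ V ∨ W ⊆ S.vars \ V := by
  by_cases hy : ∃ y ∈ W, y ∈ V
  · exact Or.inl (hV W hW hy)
  · exact Or.inr fun x hx =>
      Finset.mem_sdiff.2 ⟨h.subset_vars hW hx, fun hxV => hy ⟨x, hx, hxV⟩⟩

open scoped Classical in
theorem IsClosed.sdiff {V : Finset Var} (hV : S.IsClosed V) (h : S.WellFormed) :
    S.IsClosed (S.vars \ V) := by
  rintro W hW ⟨y, hyW, hy⟩
  rcases hV.subset_or_subset_sdiff h hW with hs | hs
  · exact absurd (hs hyW) (Finset.mem_sdiff.1 hy).2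
  · exact hs

theorem mem_slice_acts {V : Finset Var} {A : Act} :
    A ∈ (S.slice V).acts ↔ A ∈ S.acts ∧ ∃ c ∈ (S.body A).conj, c.vars ⊆ V := by
  simp [slice]

theorem mem_slice_vars {V : Finset Var} {x : Var} :
    x ∈ (S.slice V).vars ↔ x ∈ S.vars ∧ x ∈ V := by
  simp [slice]

theorem mem_slice_init {V : Finset Var} {c : InitConj Var Val} :
    c ∈ (S.slice V).init ↔ c ∈ S.init ∧ c.vars ⊆ V := by
  simp [slice]

theorem mem_slice_conj {V : Finset Var} {A : Act} {c : ActConj Var Val Param} :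
    c ∈ ((S.slice V).body A).conj ↔ c ∈ (S.body A).conj ∧ c.vars ⊆ V := by
  simp [slice]

theorem mem_slice_unch {V : Finset Var} {A : Act} {x : Var} :
    x ∈ ((S.slice V).body A).unch ↔ x ∈ (S.body A).unch ∧ x ∈ V := by
  simp [slice]

theorem WellFormed.slice (h : S.WellFormed) {V : Finset Var} (hV : S.IsClosed V) :
    (S.slice V).WellFormed where
  init_declared c hc x hx := by
    rw [mem_slice_init] at hc
    exact mem_slice_vars.2 ⟨h.init_declared c hc.1 hx, hc.2 hx⟩
  conj_declared A hA c hc x hx := by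
    rw [mem_slice_acts] at hA
    rw [mem_slice_conj] at hc
    exact mem_slice_vars.2 ⟨h.conj_declared A hA.1 c hc.1 hx, hc.2 hx⟩
  unch_declared A hA x hx := by
    rw [mem_slice_acts] at hA
    rw [mem_slice_unch] at hx
    exact mem_slice_vars.2 ⟨h.unch_declared A hA.1 hx.1, hx.2⟩
  frame A hA x hx := by
    rw [mem_slice_acts] at hA
    rw [mem_slice_vars] at hx
    rcases h.frame A hA.1 x hx.1 with hu | ⟨c, hc, hxc⟩
    · exact Or.inl (mem_slice_unch.2 ⟨hu, hx.2⟩)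
    · exact Or.inr ⟨c, mem_slice_conj.2
        ⟨hc, hV _ (Or.inr ⟨A, hA.1, c, hc, rfl⟩) ⟨x, hxc, hx.2⟩⟩, hxc⟩

theorem Steps.slice {A : Act} {d : Param} {s s' : TState Var Val} (hs : S.Steps A d s s')
    (h : S.WellFormed) {V : Finset Var} (hV : S.IsClosed V) : (S.slice V).Steps A d s s' := by
  refine ⟨fun hA => ?_, fun hA x hx => ?_⟩
  · have hH := hs.1 (mem_slice_acts.1 hA).1
    exact ⟨fun c hc => hH.1 c (mem_slice_conj.1 hc).1, fun x hx => hH.2 x (mem_slice_unch.1 hx).1⟩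
  · rw [mem_slice_vars] at hx
    by_cases hAS : A ∈ S.acts
    · rcases h.frame A hAS x hx.1 with hu | ⟨c, hc, hxc⟩
      · exact (hs.1 hAS).2 x hu
      · exact absurd (mem_slice_acts.2
          ⟨hAS, c, hc, hV _ (Or.inr ⟨A, hAS, c, hc, rfl⟩) ⟨x, hxc, hx.2⟩⟩) hA
    · exact hs.2 hAS x hx.1

open scoped Classical in
theorem slice_init_iff (h : S.WellFormed) {V : Finset Var} (hV : S.IsClosed V)
    {s : TState Var Val} :
    S.Init s ↔ (S.slice V).Init s ∧ (S.slice (S.vars \ V)).Init s := by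
  refine ⟨fun hs => ⟨fun c hc => hs c (mem_slice_init.1 hc).1,
    fun c hc => hs c (mem_slice_init.1 hc).1⟩, fun hs c hc => ?_⟩
  rcases hV.subset_or_subset_sdiff h (Or.inl ⟨c, hc, rfl⟩) with hW | hW
  exacts [hs.1 c (mem_slice_init.2 ⟨hc, hW⟩), hs.2 c (mem_slice_init.2 ⟨hc, hW⟩)]

open scoped Classical in
theorem slice_steps_iff (h : S.WellFormed) {V : Finset Var} (hV : S.IsClosed V)
    {A : Act} {d : Param} {s s' : TState Var Val} :
    S.Steps A d s s' ↔ (S.slice V).Steps A d s s' ∧ (S.slice (S.vars \ V)).Steps A d s s' := by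
  refine ⟨fun hs => ⟨hs.slice h hV, hs.slice h (hV.sdiff h)⟩, fun hs => ?_⟩
  have unch : ∀ W : Finset Var, (S.slice W).Steps A d s s' → ∀ x ∈ S.vars, x ∈ W →
      (A ∈ S.acts → x ∈ (S.body A).unch) → s' x = s x := by
    intro W hW x hxS hxW hx
    by_cases hA : A ∈ (S.slice W).acts
    · exact (hW.1 hA).2 x (mem_slice_unch.2 ⟨hx (mem_slice_acts.1 hA).1, hxW⟩)
    · exact hW.2 hA x (mem_slice_vars.2 ⟨hxS, hxW⟩)
  have conj : ∀ W : Finset Var, (S.slice W).Steps A d s s' → A ∈ S.acts →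
      ∀ c ∈ (S.body A).conj, c.vars ⊆ W → c.holds d s s' := fun W hW hA c hc hcW =>
    (hW.1 (mem_slice_acts.2 ⟨hA, c, hc, hcW⟩)).1 c (mem_slice_conj.2 ⟨hc, hcW⟩)
  -- The conditional hypothesis serves two cases: `x` in the frame of an action of `S`, and `A`
  -- foreign to `S`.
  have unch' : ∀ x ∈ S.vars, (A ∈ S.acts → x ∈ (S.body A).unch) → s' x = s x := by
    intro x hxS hx
    by_cases hxV : x ∈ V
    · exact unch V hs.1 x hxS hxV hx
    · exact unch _ hs.2 x hxS (Finset.mem_sdiff.2 ⟨hxS, hxV⟩) hx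
  refine ⟨fun hA => ⟨fun c hc => ?_, fun x hx => ?_⟩, fun hA x hx => ?_⟩
  · rcases hV.subset_or_subset_sdiff h (Or.inr ⟨A, hA, c, hc, rfl⟩) with hW | hW
    exacts [conj _ hs.1 hA c hc hW, conj _ hs.2 hA c hc hW]
  · exact unch' x (h.unch_declared A hA hx) fun _ => hx
  · exact unch' x hx fun h' => absurd h' hA

end TSpec

/-! ### Decomposition -/

section Decompose

variable {Var Val : Type u} {Act : Type v} {Param : Type w}

theorem Fixpoint.subset_and_closed {op : Set Var → Set Var} {X Z : Set Var}
    (h : Fixpoint op X Z) : X ⊆ Z ∧ op Z ⊆ Z := by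
  induction h with
  | done h => exact ⟨subset_rfl, Set.union_eq_left.1 h.symm⟩
  | step _ _ ih =>
    -- The output of the recursive call already contains what was accumulated, so the outer union
    -- adds nothing.
    rw [Set.union_eq_right.2 ih.1]
    exact ⟨Set.subset_union_left.trans ih.1, ih.2⟩

theorem PartitionVars.subset {T : TSpec Var Val Act Param} {V VC VT : Finset Var}
    (h : PartitionVars T V VC VT) : V ⊆ VC :=
  Finset.coe_subset.1 h.1.subset_and_closed.1

theorem PartitionVars.isClosed {T : TSpec Var Val Act Param} {V VC VT : Finset Var}
    (h : PartitionVars T V VC VT) : T.IsClosed VC :=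
  fun W hW hy _ hx => h.1.subset_and_closed.2 ⟨W, hW, hy, hx⟩

/-- The components `C` have disjoint sets of variables and make up the specification `T`. -/
structure IsDecomposition {ι : Type*} (T : TSpec Var Val Act Param)
    (C : ι → TSpec Var Val Act Param) : Prop where
  isLocal : ∀ i, (C i).IsLocal
  disjoint : ∀ i j, i ≠ j → Disjoint (C i).vars (C j).vars
  mem_vars : ∀ x, x ∈ T.vars ↔ ∃ i, x ∈ (C i).vars
  init_iff : ∀ s, T.Init s ↔ ∀ i, (C i).Init s
  steps_iff : ∀ A d s s', T.Steps A d s s' ↔ ∀ i, (C i).Steps A d s s'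

-- The loop invariant is that `VC` is closed and `VT` is its complement. The second conclusion, kept
-- only for the outermost round, later places the variables of `P` in the first component.
open scoped Classical in
theorem DecomposeLoop.isDecomposition {T : TSpec Var Val Act Param} {VC VT : Finset Var} {n : ℕ}
    {C : Fin (n + 1) → TSpec Var Val Act Param} (h : DecomposeLoop T VC VT n C)
    (hT : T.WellFormed) (hVC : T.IsClosed VC) (hVT : VT = T.vars \ VC) :
    IsDecomposition T C ∧ ∀ x ∈ T.vars, x ∈ VC → x ∈ (C 0).vars := by
  induction h with
  | done =>
    refine ⟨⟨fun _ => hT.isLocal, fun i j hij => absurd (Subsingleton.elim (α := Fin 1) i j) hij, ?_, ?_, ?_⟩,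
      fun x hx _ => hx⟩ <;> simp
  | @step T VC VT y VC' VT' n C _ _ hpart _ ih =>
    subst hVT
    have hcl := hVC.sdiff hT
    obtain ⟨ih, -⟩ := ih (hT.slice hcl) hpart.isClosed (by convert hpart.2)
    have hd : ∀ j, Disjoint (T.slice VC).vars (C j).vars := fun j =>
      Finset.disjoint_left.2 fun x hx hx' =>
        (Finset.mem_sdiff.1 (TSpec.mem_slice_vars.1 ((ih.mem_vars x).2 ⟨j, hx'⟩)).2).2
          (TSpec.mem_slice_vars.1 hx).2
    refine ⟨⟨?_, ?_, fun x => ?_, fun s => ?_, fun A d s s' => ?_⟩,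
      fun x hx hx' => TSpec.mem_slice_vars.2 ⟨hx, hx'⟩⟩
    · exact Fin.cases (hT.slice hVC).isLocal ih.isLocal
    · refine Fin.cases (Fin.cases (fun h => absurd rfl h) fun j _ => hd j)
        fun i => Fin.cases (fun _ => (hd i).symm) fun j hij => ?_
      exact ih.disjoint i j fun h => hij (h ▸ rfl)
    · rw [Fin.exists_fin_succ]
      simp only [Fin.cons_zero, Fin.cons_succ, ← ih.mem_vars, TSpec.mem_slice_vars,
        Finset.mem_sdiff]
      tauto
    · rw [Fin.forall_fin_succ]
      simp only [Fin.cons_zero, Fin.cons_succ, ← ih.init_iff]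
      exact TSpec.slice_init_iff hT hVC
    · rw [Fin.forall_fin_succ]
      simp only [Fin.cons_zero, Fin.cons_succ, ← ih.steps_iff]
      exact TSpec.slice_steps_iff hT hVC

theorem Decompose.isDecomposition {S : TSpec Var Val Act Param} {P : TProperty Var Val} {n : ℕ}
    {C : Fin (n + 1) → TSpec Var Val Act Param} (h : Decompose S P n C) (hS : S.WellFormed)
    (hvars : P.vars ⊆ S.vars) : IsDecomposition S C ∧ P.vars ⊆ (C 0).vars := by
  obtain ⟨VC, VT, hpart, hloop⟩ := h
  obtain ⟨h1, h2⟩ := hloop.isDecomposition hS hpart.isClosed hpart.2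
  exact ⟨h1, fun x hx => h2 x (hvars hx) (hpart.subset hx)⟩

end Decompose

/-! ### Violations of the specification are found by every composition -/

section Follows

variable {Var Val : Type u} {Act : Type v} {Param : Type w}

/-- `M` can follow the histories of `S` until it reaches the error state, which it does when nothing
meets the remaining obligation if `e` holds. -/
def LTS.Follows (S : TSpec Var Val Act Param) (P : TProperty Var Val) (e : Prop)
    (M : LTS.{u, max v w} (Act × Param)) : Prop :=
  ∃ F : TState Var Val → Set (Behavior Var Val) → M.Q → Prop,
    (∀ s, S.Init s → ∃ q ∈ M.init, F s (residualObl s P.behaviors) q) ∧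
    (∀ s R q, F s R q → e → R = ∅ → q ∈ M.err) ∧
    (∀ s R q s', F s R q → (∀ x ∈ S.vars, s' x = s x) → F s' (residualObl s' R) q) ∧
    ∀ s R q A d s', F s R q → S.Steps A d s s' → q ∈ M.err ∨
      ((A, d) ∈ M.alphabet ∧ ∃ q', M.δ q (A, d) q' ∧ F s' (residualObl s' R) q') ∨
      ((A, d) ∉ M.alphabet ∧ F s' (residualObl s' R) q)

namespace LTS.Follows

variable {S : TSpec Var Val Act Param} {P : TProperty Var Val} {e : Prop}
  {M N : LTS.{u, max v w} (Act × Param)}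

/-- This makes it harmless to replace an LTS with its minimization. -/
theorem sim (h : M.Follows S P e) (k : M.Sim N) : N.Follows S P e := by
  obtain ⟨F, hi, he, hst, hs⟩ := h
  obtain ⟨ha, T, ki, hT⟩ := k
  refine ⟨fun s R r => ∃ q, F s R q ∧ T q r, fun s h0 => ?_, ?_, ?_, ?_⟩
  · obtain ⟨q, hq, h1⟩ := hi s h0
    obtain ⟨r, hr, h2⟩ := ki q hq
    exact ⟨r, hr, q, h1, h2⟩
  · rintro s R r ⟨q, h1, h2⟩ h3 hR
    exact (hT q r h2).1 (he s R q h1 h3 hR)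
  · rintro s R r s' ⟨q, h1, h2⟩ h3
    exact ⟨q, hst s R q s' h1 h3, h2⟩
  · rintro s R r A d s' ⟨q, h1, h2⟩ h3
    rcases hs s R q A d s' h1 h3 with h | ⟨hM, q', hδ, h1'⟩ | ⟨hM, h1'⟩
    · exact Or.inl ((hT q r h2).1 h)
    · rcases (hT q r h2).2 _ hM q' hδ with hr | ⟨r', hr', h2'⟩
      · exact Or.inl hr
      · exact Or.inr (Or.inl ⟨ha ▸ hM, r', hr', q', h1', h2'⟩)
    · exact Or.inr (Or.inr ⟨ha ▸ hM, q, h1', h2⟩)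

/-- Only the left factor has to detect violations; the right one just must not block a step of `S`.
-/
theorem par {e' : Prop} (h : M.Follows S P e) (k : N.Follows S P e') :
    (M.par N).Follows S P e := by
  obtain ⟨F, hi, he, hst, hs⟩ := h
  obtain ⟨G, ki, -, kst, ks⟩ := k
  refine ⟨fun s R q => F s R q.1 ∧ G s R q.2, fun s h0 => ?_, ?_, ?_, ?_⟩
  · obtain ⟨q, hq, h1⟩ := hi s h0
    obtain ⟨r, hr, h2⟩ := ki s h0
    exact ⟨(q, r), ⟨hq, hr⟩, h1, h2⟩
  · rintro s R q ⟨h1, -⟩ h3 hR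
    exact Or.inl (he s R _ h1 h3 hR)
  · rintro s R q s' ⟨h1, h2⟩ h3
    exact ⟨hst s R _ s' h1 h3, kst s R _ s' h2 h3⟩
  · rintro s R q A d s' ⟨h1, h2⟩ h3
    rcases hs s R _ A d s' h1 h3 with h | ⟨hM, q1, hδ, h1'⟩ | ⟨hM, h1'⟩
    · exact Or.inl (Or.inl h)
    · rcases ks s R _ A d s' h2 h3 with h | ⟨hN, q2, kδ, h2'⟩ | ⟨hN, h2'⟩
      · exact Or.inl (Or.inr h)
      · exact Or.inr (Or.inl ⟨Or.inl hM, (q1, q2), Or.inl ⟨hM, hN, hδ, kδ⟩, h1', h2'⟩)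
      · exact Or.inr (Or.inl ⟨Or.inl hM, (q1, q.2), Or.inr (Or.inl ⟨hM, hN, hδ, rfl⟩), h1', h2'⟩)
    · rcases ks s R _ A d s' h2 h3 with h | ⟨hN, q2, kδ, h2'⟩ | ⟨hN, h2'⟩
      · exact Or.inl (Or.inr h)
      · exact Or.inr (Or.inl ⟨Or.inr hN, (q.1, q2), Or.inr (Or.inr ⟨hM, hN, rfl, kδ⟩), h1', h2'⟩)
      · exact Or.inr (Or.inr ⟨fun h => h.elim hM hN, h1', h2'⟩)

theorem errReachable (h : M.Follows S P True) (hP : P.IsSafety) (hS : ¬ S.Satisfies P) :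
    M.ErrReachable := by
  obtain ⟨F, hi, he, hst, hs⟩ := h
  obtain ⟨s, hconf⟩ := TSpec.exists_config_empty hP hS
  have key : ∀ s R, S.Config P s R → M.ErrReachable ∨ ∃ q, M.Reach q ∧ F s R q := by
    intro s R hc
    induction hc with
    | init h0 =>
      obtain ⟨q, hq, h1⟩ := hi _ h0
      exact Or.inr ⟨q, .init hq, h1⟩
    | step _ hstep ih =>
      rcases ih with h | ⟨q, hq, h1⟩
      · exact Or.inl h
      rcases hstep with ⟨d, A, hA, hH⟩ | hu
      · rcases hs _ _ q A d _ h1 ⟨fun _ => hH, fun h => absurd hA h⟩ with h | ⟨hM, q', hδ, h'⟩ | h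
        · exact Or.inl ⟨q, hq, h⟩
        · exact Or.inr ⟨q', hq.step hM hδ, h'⟩
        · exact Or.inr ⟨q, hq, h.2⟩
      · exact Or.inr ⟨q, hq, hst _ _ q _ h1 hu⟩
  rcases key s _ hconf with h | ⟨q, hq, h1⟩
  · exact h
  · exact ⟨q, hq, he _ _ q h1 trivial rfl⟩

end LTS.Follows

/-! ### Error states, and the LTSs of weakened specifications -/

namespace TSpec

variable {S D E : TSpec Var Val Act Param} {P : TProperty Var Val}

theorem restrict_congr {s t : TState Var Val} (h : ∀ x ∈ D.vars, s x = t x) :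
    D.restrict s = D.restrict t :=
  funext fun x => h x.1 x.2

theorem eq_of_restrict_eq {s t : TState Var Val} (h : D.restrict s = D.restrict t) :
    ∀ x ∈ D.vars, s x = t x :=
  fun x hx => congrFun h ⟨x, hx⟩

theorem errState_congr {s t : TState Var Val} (h : ∀ x ∈ D.vars, s x = t x)
    (R : Set (Behavior Var Val)) : D.errState s R = D.errState t R := by
  simp only [errState, restrict_congr h]

theorem errState_of_ne {R : Set (Behavior Var Val)} (hR : R ≠ ∅) (s : TState Var Val) :
    D.errState s R = some (D.restrict s, R) :=
  if_neg hR

theorem errState_empty (s : TState Var Val) : D.errState s ∅ = none :=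
  if_pos rfl

theorem errState_eq_none_iff {s : TState Var Val} {R : Set (Behavior Var Val)} :
    D.errState s R = none ↔ R = ∅ := by
  by_cases hR : R = ∅ <;> simp [errState, hR]

theorem errState_eq_some {s t : TState Var Val} {R R' : Set (Behavior Var Val)}
    (h : D.errState s R = some (D.restrict t, R')) : R = R' ∧ ∀ x ∈ D.vars, s x = t x := by
  by_cases hR : R = ∅
  · subst hR
    rw [errState_empty] at h
    cases h
  · rw [errState_of_ne hR, Option.some.injEq, Prod.mk.injEq] at h
    exact ⟨h.2, eq_of_restrict_eq h.1⟩

theorem toLTS_follows (hv : D.vars ⊆ S.vars) (hi : ∀ s, S.Init s → D.Init s)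
    (hs : ∀ A d s s', S.Steps A d s s' → D.Steps A d s s') : D.toLTS.Follows S P False := by
  refine ⟨fun s _ q => q = D.restrict s, fun s h0 => ⟨_, ⟨s, rfl, hi s h0⟩, rfl⟩,
    fun _ _ _ _ h => h.elim, ?_, ?_⟩
  · rintro s R _ s' rfl h
    exact restrict_congr fun x hx => (h x (hv hx)).symm
  · rintro s R _ A d s' rfl h
    right
    by_cases hA : A ∈ D.acts
    · exact Or.inl ⟨hA, _, ⟨hA, s, s', rfl, rfl, (hs A d s s' h).1 hA⟩, rfl⟩
    · exact Or.inr ⟨hA, restrict_congr fun x hx => ((hs A d s s' h).2 hA x hx).symm⟩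

/-- The follower of `s` and `R` is the error state that they determine. As the variables of `P`
belong to `D`, actions foreign to `D` change neither of its two entries. -/
theorem errLTS_follows (hP : P.vars ⊆ D.vars) (hv : D.vars ⊆ S.vars)
    (hi : ∀ s, S.Init s → D.Init s) (hs : ∀ A d s s', S.Steps A d s s' → D.Steps A d s s') :
    (D.errLTS P).Follows S P True := by
  have stut : ∀ {s s' : TState Var Val} {R : Set (Behavior Var Val)}, IsResidual D.vars s R →
      (∀ x ∈ D.vars, s' x = s x) → IsResidual D.vars s' (residualObl s' R) ∧
        D.errState s R = D.errState s' (residualObl s' R) := fun hR h =>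
    ⟨hR.next _, by rw [hR.stutter h, errState_congr h]⟩
  refine ⟨fun s R q => IsResidual D.vars s R ∧ q = D.errState s R,
    fun s h0 => ⟨_, ⟨s, rfl, hi s h0⟩, ⟨P, hP, rfl⟩, rfl⟩, ?_, ?_, ?_⟩
  · rintro s _ _ ⟨-, rfl⟩ - rfl
    exact errState_empty s
  · rintro s R _ s' ⟨hR, rfl⟩ h
    exact stut hR fun x hx => h x (hv hx)
  · rintro s R _ A d s' ⟨hR, rfl⟩ h
    by_cases h0 : R = ∅
    · exact Or.inl (errState_eq_none_iff.2 h0)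
    right
    by_cases hA : A ∈ D.acts
    · exact Or.inl ⟨hA, _, ⟨hA, s, s', R, errState_of_ne h0 s, rfl, (hs A d s s' h).1 hA⟩,
        hR.next _, rfl⟩
    · exact Or.inr ⟨hA, stut hR ((hs A d s s' h).2 hA)⟩

/-! ### Errors of the composition are violations of the specification -/

open scoped Classical in
theorem errLTS_par_sim (hE : E.IsLocal) (hD : D.IsLocal) (hED : Disjoint E.vars D.vars)
    (hP : P.vars ⊆ E.vars) : ((E.errLTS P).par D.toLTS).Sim ((E.par D).errLTS P) := by
  have glue : ∀ t u r : TState Var Val, ∃ s : TState Var Val, (∀ x ∈ E.vars, t x = s x) ∧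
      ∀ x ∈ D.vars, u x = s x := fun t u r =>
    ⟨fun x => if x ∈ E.vars then t x else u x, fun x hx => by simp [hx], fun x hx => by
      simp [Finset.disjoint_right.1 hED hx]⟩
  have hacts : ∀ A, A ∈ (E.par D).acts ↔ A ∈ E.acts ∨ A ∈ D.acts := fun A => Finset.mem_union
  refine ⟨?_, fun p q => ∃ s R, IsResidual E.vars s R ∧ p.1 = E.errState s R ∧
    p.2 = D.restrict s ∧ q = (E.par D).errState s R, ?_, ?_⟩
  · ext a
    exact (hacts a.1).symm
  · rintro ⟨p1, p2⟩ ⟨⟨t, h1, ht⟩, ⟨r, h2, hr⟩⟩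
    obtain ⟨s, hs1, hs2⟩ := glue t r t
    have hres : residualObl t P.behaviors = residualObl s P.behaviors :=
      P.residualObl_congr fun x hx => hs1 x (hP hx)
    refine ⟨_, ⟨s, rfl, par_init_iff.2 ⟨hE.init t s hs1 ht, hD.init r s hs2 hr⟩⟩, s, _,
      ⟨P, hP, rfl⟩, ?_, h2.trans (restrict_congr hs2), rfl⟩
    rw [← hres]
    exact h1.trans (errState_congr hs1 _)
  · rintro ⟨p1, p2⟩ q ⟨s, R, hR, h1, h2, rfl⟩
    simp only at h1 h2
    subst h1 h2
    constructor
    · rintro (h | h)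
      · exact errState_eq_none_iff.2 (errState_eq_none_iff.1 h)
      · exact h.elim
    rintro ⟨A, d⟩ ha ⟨p1', p2'⟩ hδ
    -- In the composition `D` may still move once `E` has reached `π`, whereas `π` is a sink on the
    -- right; `Sim` asks for no match from there on.
    by_cases h0 : R = ∅
    · exact Or.inl (errState_eq_none_iff.2 h0)
    right
    have step : ∀ s', E.Steps A d s s' → D.Steps A d s s' →
        ((E.par D).errLTS P).δ ((E.par D).errState s R) (A, d)
          ((E.par D).errState s' (residualObl s' R)) := fun s' hs1 hs2 =>
      ⟨(hacts A).2 ha, s, s', R, errState_of_ne h0 s, rfl,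
        (par_steps_iff.2 ⟨hs1, hs2⟩).1 ((hacts A).2 ha)⟩
    have hE' : (A, d) ∈ (E.errLTS P).alphabet → (E.errLTS P).δ (E.errState s R) (A, d) p1' →
        ∃ t', p1' = E.errState t' (residualObl t' R) ∧
          ∀ s', (∀ x ∈ E.vars, t' x = s' x) → E.Steps A d s s' := by
      rintro - ⟨hA, t, t', R', h1, rfl, hH⟩
      obtain ⟨rfl, hst⟩ := errState_eq_some h1
      exact ⟨t', rfl, fun s' hs' => hE.steps A d t t' s s' (fun x hx => (hst x hx).symm) hs'
        ⟨fun _ => hH, fun h => absurd hA h⟩⟩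
    have hD' : D.toLTS.δ (D.restrict s) (A, d) p2' → ∃ r', p2' = D.restrict r' ∧
          ∀ s', (∀ x ∈ D.vars, r' x = s' x) → D.Steps A d s s' := by
      rintro ⟨hA, r, r', h1, rfl, hH⟩
      exact ⟨r', rfl, fun s' hs' => hD.steps A d r r' s s'
        (fun x hx => (eq_of_restrict_eq h1 x hx).symm) hs' ⟨fun _ => hH, fun h => absurd hA h⟩⟩
    -- One argument for all three kinds of steps: a component that does not move takes `s` itself as
    -- its next state.
    have fin : ∀ t' r' : TState Var Val, p1' = E.errState t' (residualObl t' R) →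
        p2' = D.restrict r' →
        (∀ s', (∀ x ∈ E.vars, t' x = s' x) → E.Steps A d s s') →
        (∀ s', (∀ x ∈ D.vars, r' x = s' x) → D.Steps A d s s') →
        ∃ q', ((E.par D).errLTS P).δ ((E.par D).errState s R) (A, d) q' ∧
          ∃ s R, IsResidual E.vars s R ∧ p1' = E.errState s R ∧
            p2' = D.restrict s ∧ q' = (E.par D).errState s R := by
      rintro t' r' rfl rfl ht hr
      obtain ⟨s', hs1, hs2⟩ := glue t' r' s
      refine ⟨_, step s' (ht s' hs1) (hr s' hs2), s', _, hR.next s', ?_, restrict_congr hs2, rfl⟩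
      rw [hR.congr hs1, errState_congr hs1]
    rcases hδ with ⟨hA, hA', d1, d2⟩ | ⟨hA, hA', d1, d2⟩ | ⟨hA, hA', d1, d2⟩
    · obtain ⟨t', e1, ht⟩ := hE' hA d1
      obtain ⟨r', e2, hr⟩ := hD' d2
      exact fin t' r' e1 e2 ht hr
    · obtain ⟨t', e1, ht⟩ := hE' hA d1
      exact fin t' s e1 d2 ht fun s' hs' => ⟨fun h => absurd h hA', fun _ x hx => (hs' x hx).symm⟩
    · obtain ⟨r', e2, hr⟩ := hD' d2
      refine fin s r' ?_ e2 (fun s' hs' => ⟨fun h => absurd h hA, fun _ x hx => (hs' x hx).symm⟩) hr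
      rw [hR.stutter fun _ _ => rfl]
      exact d1

open scoped Classical in
/-- The errors of a part of the components that shares no actions with the other components are
violations of the whole specification. -/
theorem not_satisfies_of_errReachable {ι : Type*} {C : ι → TSpec Var Val Act Param} {I : Set ι}
    (hC : IsDecomposition S C) (hE : Represents C I E) (hP : P.vars ⊆ E.vars)
    (hI : ∀ i ∈ I, ∀ j ∉ I, ∀ A ∈ (C i).acts, A ∉ (C j).acts) (hInit : ∃ s, S.Init s)
    (h : (E.errLTS P).ErrReachable) : ¬ S.Satisfies P := by
  obtain ⟨s0, hs0⟩ := hInit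
  let glue : TState Var Val → TState Var Val → TState Var Val := fun t r x =>
    if x ∈ E.vars then t x else r x
  have glue1 : ∀ t r, ∀ x ∈ E.vars, t x = glue t r x := fun t r x hx => by simp [glue, hx]
  have glue2 : ∀ t r, ∀ j ∉ I, ∀ x ∈ (C j).vars, r x = glue t r x := fun t r j hj x hx => by
    have : x ∉ E.vars := fun h => by
      obtain ⟨i, hi, hx'⟩ := (hE.mem_vars x).1 h
      exact Finset.disjoint_left.1 (hC.disjoint i j fun h => hj (h ▸ hi)) hx' hx
    simp [glue, this]
  have hloc := hE.isLocal hC.isLocal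
  have key : ∀ q, (E.errLTS P).Reach q → ∃ s R, S.Config P s R ∧ q = E.errState s R := by
    intro q hq
    induction hq with
    | init h =>
      obtain ⟨t, rfl, ht⟩ := h
      -- Components outside `I` start from the values of the global initial state `s0`; this is
      -- where satisfiability of `Init` enters.
      refine ⟨glue t s0, _, .init ((hC.init_iff _).2 fun i => ?_), ?_⟩
      · by_cases hi : i ∈ I
        · exact (hE.init_iff _).1 (hloc.init t _ (glue1 t s0) ht) i hi
        · exact (hC.isLocal i).init s0 _ (glue2 t s0 i hi) ((hC.init_iff s0).1 hs0 i)
      · rw [P.residualObl_congr fun x hx => glue1 t s0 x (hP hx), errState_congr (glue1 t s0)]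
    | @step q a q' _ _ hδ ih =>
      obtain ⟨s, R, hs, rfl⟩ := ih
      obtain ⟨hA, t, t', R', h1, rfl, hH⟩ := hδ
      obtain ⟨rfl, hst⟩ := errState_eq_some h1
      have hsteps : S.Steps a.1 a.2 s (glue t' s) := (hC.steps_iff _ _ _ _).2 fun i => by
        by_cases hi : i ∈ I
        · exact (hE.steps_iff _ _ _ _).1 (hloc.steps _ _ t t' s _ (fun x hx => (hst x hx).symm)
            (glue1 t' s) ⟨fun _ => hH, fun h => absurd hA h⟩) i hi
        · obtain ⟨j, hj, hjA⟩ := (hE.mem_acts a.1).1 hA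
          -- An action of `E` is foreign to every component outside `I`, which thus only has to stay
          -- put.
          exact ⟨fun h => absurd h (hI j hj i hi _ hjA), fun _ x hx => (glue2 t' s i hi x hx).symm⟩
      -- `IsDecomposition` does not say that the action belongs to `S`, so the step may count as
      -- stuttering, which `Config` admits.
      refine ⟨glue t' s, _, hs.step hsteps.stepOrStutter, ?_⟩
      rw [(hs.isResidual.mono hP).congr (glue1 t' s), errState_congr (glue1 t' s)]
  obtain ⟨q, hq, hqe⟩ := h
  obtain ⟨s, R, hs, rfl⟩ := key q hq
  obtain rfl := errState_eq_none_iff.1 hqe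
  exact hs.not_satisfies

end TSpec

end Follows

/-! ### Verification -/

section Verify

variable {Var Val : Type u} {Act : Type v} {Param : Type w}
  {S : TSpec Var Val Act Param} {P : TProperty Var Val}

theorem CompVerifyLoop.satisfies (hP : P.IsSafety) {Ds : List (TSpec Var Val Act Param)}
    (hDs : ∀ D ∈ Ds, D.toLTS.Follows S P False) {M : LTS.{u, max v w} (Act × Param)}
    (hM : M.Follows S P True) (h : CompVerifyLoop M Ds true) : S.Satisfies P := by
  induction Ds generalizing M with
  | nil =>
    cases h with
    | success h => exact by_contra fun hS => h (hM.errReachable hP hS)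
  | cons D Ds ih =>
    cases h with
    | success h => exact by_contra fun hS => h (hM.errReachable hP hS)
    | next _ _ h =>
      exact ih (fun E hE => hDs E (List.mem_cons_of_mem _ hE))
        (hM.par ((hDs D List.mem_cons_self).sim D.toLTS.sim_min)) h

variable {n : ℕ} {C : Fin (n + 1) → TSpec Var Val Act Param}

theorem recompose_represents (F : RecompMap n) (d : Option (Fin F.m)) :
    TSpec.Represents C {i | ∃ h : i ∈ F.dom, F.f ⟨i, h⟩ = d} (recompose C F d) := by
  classical
  have := TSpec.Represents.parList C
    ((List.finRange (n + 1)).filter (fun i => ∃ h : i ∈ F.dom, F.f ⟨i, h⟩ = d))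
  simp only [List.mem_filter, List.mem_finRange, true_and, decide_eq_true_eq] at this
  exact this

/-- The components that are sent to a member of `K`. -/
def RecompMap.preimage (F : RecompMap n) (K : Set (Option (Fin F.m))) : Set (Fin (n + 1)) :=
  {i | ∃ h : i ∈ F.dom, F.f ⟨i, h⟩ ∈ K}

/-- `K` collects the targets composed so far and `E` is their composition; each round adds one
target to both. Distinctness of the targets keeps the variables disjoint, as `errLTS_par_sim`
requires. -/
theorem CompVerifyLoop.errReachable (hC : IsDecomposition S C) (F : RecompMap n)
    {l : List (Fin F.m)} (hl : l.Nodup) {K : Set (Option (Fin F.m))} (hK : ∀ j ∈ l, some j ∉ K)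
    {E : TSpec Var Val Act Param} (hE : TSpec.Represents C (F.preimage K) E)
    (hP : P.vars ⊆ E.vars) {M : LTS.{u, max v w} (Act × Param)} (hM : M.Sim (E.errLTS P))
    (h : CompVerifyLoop M (l.map fun j => recompose C F (some j)) false) :
    ∃ E', TSpec.Represents C (F.preimage (K ∪ some '' {j | j ∈ l})) E' ∧ P.vars ⊆ E'.vars ∧
      (E'.errLTS P).ErrReachable := by
  classical
  induction l generalizing K E M with
  | nil =>
    cases h with
    | failure h => exact ⟨E, by simpa using hE, hP, hM.errReachable h⟩
  | cons j l ih =>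
    cases h with
    | next _ _ h =>
      have hD : TSpec.Represents C _ (recompose C F (some j)) := recompose_represents F (some j)
      have hdisj : Disjoint (F.preimage K) {i | ∃ h : i ∈ F.dom, F.f ⟨i, h⟩ = some j} :=
        Set.disjoint_left.2 fun i ⟨_, hi⟩ ⟨_, hi'⟩ => hK j List.mem_cons_self (hi' ▸ hi)
      have hunion : F.preimage K ∪ {i | ∃ h : i ∈ F.dom, F.f ⟨i, h⟩ = some j} =
          F.preimage (K ∪ {some j}) := by
        ext i
        simp only [RecompMap.preimage, Set.mem_union, Set.mem_ofPred_eq, Set.mem_singleton_iff,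
          ← exists_or]
      have hED := hE.par hD
      rw [hunion] at hED
      obtain ⟨E', hE', hE'P⟩ := ih hl.of_cons (K := K ∪ {some j}) (fun k hk hkK => by
          rcases hkK with hkK | hkK
          · exact hK k (List.mem_cons_of_mem _ hk) hkK
          · obtain rfl := Option.some_injective _ hkK
            exact (List.nodup_cons.1 hl).1 hk) hED (hP.trans Finset.subset_union_left)
        ((hM.par (LTS.min_sim _)).trans (TSpec.errLTS_par_sim (hE.isLocal hC.isLocal)
          (hD.isLocal hC.isLocal) (hE.disjoint_vars hD hdisj hC.disjoint) hP)) h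
      have hset : K ∪ {some j} ∪ some '' {k | k ∈ l} = K ∪ some '' {k | k ∈ j :: l} := by
        rw [Set.union_assoc]
        congr 1
        ext k
        simp [eq_comm]
      exact ⟨E', hset ▸ hE', hE'P⟩

theorem RecompVerify.eq_true_iff (hS : S.WellFormed) (hInit : ∃ s, S.Init s) (hP : P.IsSafety)
    (hvars : P.vars ⊆ S.vars) {ρ : RecompStrategy Var Val Act Param} {b : Bool}
    (h : RecompVerify S P ρ b) : b = true ↔ S.Satisfies P := by
  obtain ⟨n, C, F, hdec, hF, -, hrun⟩ := h
  obtain ⟨hC, hPC⟩ := hdec.isDecomposition hS hvars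
  have hdom : F.dom = necessary C := by
    rw [hF]
    exact (congrArg (· ∩ necessary C) (ρ n C).2).trans (Set.univ_inter _)
  have hPD : P.vars ⊆ (recompose C F none).vars :=
    hPC.trans ((recompose_represents F none).vars_subset ⟨F.first_mem, F.first⟩)
  cases b with
  | true =>
    refine iff_of_true rfl ?_
    -- Each recomposed part is a conjunction of some of the components, hence weaker than `S`;
    -- dropping components by static reduction does not affect this.
    have sub : ∀ d, (recompose C F d).vars ⊆ S.vars ∧
        (∀ s, S.Init s → (recompose C F d).Init s) ∧
        ∀ A a s s', S.Steps A a s s' → (recompose C F d).Steps A a s s' := by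
      intro d
      have hd : TSpec.Represents C _ (recompose C F d) := recompose_represents F d
      refine ⟨fun x hx => ?_, fun s hs => ?_, fun A a s s' hs => ?_⟩
      · obtain ⟨i, -, hi⟩ := (hd.mem_vars x).1 hx
        exact (hC.mem_vars x).2 ⟨i, hi⟩
      · exact (hd.init_iff s).2 fun i _ => (hC.init_iff s).1 hs i
      · exact (hd.steps_iff A a s s').2 fun i _ => (hC.steps_iff A a s s').1 hs i
    refine hrun.satisfies hP (fun D hD => ?_) ((TSpec.errLTS_follows hPD (sub none).1
      (sub none).2.1 (sub none).2.2).sim (LTS.sim_min _))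
    obtain ⟨j, -, rfl⟩ := List.mem_map.1 hD
    exact TSpec.toLTS_follows (sub _).1 (sub _).2.1 (sub _).2.2
  | false =>
    refine iff_of_false Bool.false_ne_true ?_
    obtain ⟨E, hE, hPE, herr⟩ := hrun.errReachable hC F (List.nodup_finRange _)
      (K := {none}) (by simp) (recompose_represents F none) hPD (LTS.min_sim _)
    have hpre : F.preimage ({none} ∪ some '' {j | j ∈ List.finRange F.m}) = necessary C := by
      rw [← hdom]
      ext i
      refine ⟨fun h => h.1, fun h => ⟨h, ?_⟩⟩
      cases F.f ⟨i, h⟩ <;> simp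
    rw [hpre] at hE
    refine TSpec.not_satisfies_of_errReachable hC hE hPE (fun i hi j hj A hA hA' => hj ?_) hInit herr
    -- A component that shares an action with a member of `X_k` lies in `X_{k+1}`, so the necessary
    -- components are closed under sharing actions.
    obtain ⟨k, hk⟩ := Set.mem_iUnion.1 hi
    exact Set.mem_iUnion.2 ⟨k + 1, i, hk, A, hA', hA⟩

end Verify

theorem theorem2 {Var Val : Type u} {Act : Type v} {Param : Type w}
    (S : TSpec Var Val Act Param) (hS : S.WellFormed) (hInit : ∃ s : TState Var Val, S.Init s)
    (P : TProperty Var Val) (hP : P.IsSafety) (hvars : P.vars ⊆ S.vars)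
    (ρ : RecompStrategy Var Val Act Param) (b : Bool) (hrun : RecompVerify S P ρ b) :
    b = true ↔ S.Satisfies P :=
  hrun.eq_true_iff hS hInit hP hvars
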